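/- **Theorem 1 (Robust Recovery).** Let $0\le M<N$. There are $N$ clients $[N]=\{1,\dots,N\}$ and $K$ packets, and client $i$ initially holds a set $X_i$ of packets. A coding scheme divides each packet into $L\ge 1$ chunks of equal size, a chunk being an element of a finite alphabet $A$ with $|A|\ge 2$ (for example a finite field). In each of finitely many time slots a prescribed client broadcasts one element of $A$, computed from its own packets and from what it received in earlier slots; such a transmission counts as $1/L$ of a (packet) transmission. The scheme achieves *robust recovery* if, for every set $\mathcal I\subset[N]$ with $|\mathcal I|=M$ (the unreliable clients), unknown to the encoders and decoders, and for arbitrary erasures of transmissions of the clients in $\mathcal I$ (and of no others), every client $i\notin\mathcal I$ recovers all the packets held by the clients outside $\mathcal I$. For $\mathcal I\subset[N]$ and $i\notin\mathcal I$ put $\overline X_{i,\mathcal I}=\bigl(\bigcup_{j\in[N]\setminus\mathcal I}X_j\bigr)\setminus X_i$, let $\overline{\mathcal N}=[N]\setminus\mathcal N$ and $P=N-M-1$, and consider the linear program $$\text{minimize }\sum_{i=1}^N r_i\quad\text{subject to } r_i\ge 0\ (i\in[N]),\qquad \sum_{i\in\mathcal N}r_i\ \ge\max_{\mathcal I\subset\overline{\mathcal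 N},\ |\mathcal I|=M}\Bigl|\bigcap_{i\in\overline{\mathcal N}\setminus\mathcal I}\overline X_{i,\mathcal I}\Bigr|\quad\text{for all }\mathcal N\subset[N]\text{ with }1\le|\mathcal N|\le P .$$ (a) If packets may be divided into any number of chunks, then the minimum total number of transmissions required for robust recovery exists and equals the optimal value of this linear program, which is attained. (b) If each packet is divided into a given number $L\ge1$ of chunks (for example $L=P$, when $P\ge 1$), then the minimum total number of transmissions required for robust recovery equals the optimal value of the same program with every $r_i$ restricted to the multiples $n/L$, $n\in\{0,1,2,\dots\}$. In both cases the minimum is the same if only linear schemes are allowed, in which the alphabet is a finite field and each transmission is a fixed linear combination of the chunks of the packets held by its sender. -/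

import Mathlib

/-! ### The linear program

`N` clients, `K` packets, `X i` is the set of packets held by client `i`. -/

/-- The packets that client `i` requires when the unreliable clients are those in `I`: the packets
held by some reliable client but not by `i`. -/
def requiredPackets {N K : ℕ} (X : Fin N → Finset (Fin K)) (I : Finset (Fin N)) (i : Fin N) :
    Finset (Fin K) :=
  (Iᶜ.biUnion X) \ X i

/-- The packets that all clients outside `S ∪ I` require when the unreliable clients are those
in `I`. -/
def commonRequired {N K : ℕ} (X : Fin N → Finset (Fin K)) (S I : Finset (Fin N)) :
    Finset (Fin K) :=
  Finset.univ.filter fun x => ∀ i ∈ Sᶜ \ I, x ∈ requiredPackets X I i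

/-- The right-hand side of the constraint of `S`: the maximum of `|commonRequired X S I|` over all
`M`-element sets `I` of clients that are disjoint from `S`. -/
def constraintBound {N K : ℕ} (X : Fin N → Finset (Fin K)) (M : ℕ) (S : Finset (Fin N)) : ℕ :=
  (Sᶜ.powersetCard M).sup fun I => (commonRequired X S I).card

/-- `r` is a feasible point of the linear program: it is nonnegative, and there is one constraint
for every set `S` of clients with `1 ≤ |S| ≤ N - M - 1`. -/
def LPFeasible {N K : ℕ} (X : Fin N → Finset (Fin K)) (M : ℕ) (r : Fin N → ℝ) : Prop :=
  (∀ i, 0 ≤ r i) ∧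
  ∀ S : Finset (Fin N), 1 ≤ S.card → S.card ≤ N - M - 1 →
    (constraintBound X M S : ℝ) ≤ ∑ i ∈ S, r i

/-- The values of the objective function at the feasible points. -/
def lpValues {N K : ℕ} (X : Fin N → Finset (Fin K)) (M : ℕ) : Set ℝ :=
  {s | ∃ r : Fin N → ℝ, LPFeasible X M r ∧ s = ∑ i, r i}

/-- The values of the objective function at the feasible points all of whose coordinates are
integer multiples of `1 / L`. -/
def lpValuesDiv {N K : ℕ} (X : Fin N → Finset (Fin K)) (M L : ℕ) : Set ℝ :=
  {s | ∃ r : Fin N → ℝ, LPFeasible X M r ∧ (∀ i, ∃ n : ℕ, r i = (n : ℝ) / L) ∧ s = ∑ i, r i}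

/-! ### Coding schemes and robust recovery

Each packet consists of `L` chunks, a chunk is an element of `A`, and a transmission is an
element of `A`, that is, it has the size of one chunk. -/

/-- A coding scheme. There are `T` time slots; in slot `t` client `sender t` broadcasts
an element of `A` that depends on the packets it holds and on what it received in the earlier
slots (`none` stands for an erasure). In the end each client computes an estimate of all packets
from the packets that it holds and from all that it received. Neither the encoders nor the
decoders know which clients are unreliable. -/
structure CodingScheme {N K : ℕ} (X : Fin N → Finset (Fin K)) (L : ℕ) (A : Type) where
  /-- number of transmissions -/
  T : ℕ
  /-- the client that broadcasts in a given slot -/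
  sender : Fin T → Fin N
  /-- the encoder of each slot -/
  enc : (t : Fin T) → ({x // x ∈ X (sender t)} → Fin L → A) → (Fin t.val → Option A) → A
  /-- the decoder of each client -/
  dec : (i : Fin N) → ({x // x ∈ X i} → Fin L → A) → (Fin T → Option A) → Fin K → Fin L → A

namespace CodingScheme

variable {N K : ℕ} {X : Fin N → Finset (Fin K)} {L : ℕ} {A : Type}

/-- What is broadcast in slot `t`, when `w` is the content of the packets and `E` the erasure
pattern: `E i s = true` means that client `i` does not receive the transmission of slot `s`. -/
def sent (σ : CodingScheme X L A) (w : Fin K → Fin L → A) (E : Fin N → Fin σ.T → Bool)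
    (t : Fin σ.T) : A :=
  σ.enc t (fun x => w x.1) fun s : Fin t.val =>
    if E (σ.sender t) ⟨s.val, s.isLt.trans t.isLt⟩ then none
    else some (sent σ w E ⟨s.val, s.isLt.trans t.isLt⟩)
termination_by t.val
decreasing_by exact s.isLt

/-- What client `i` receives. -/
def received (σ : CodingScheme X L A) (w : Fin K → Fin L → A) (E : Fin N → Fin σ.T → Bool)
    (i : Fin N) (t : Fin σ.T) : Option A :=
  if E i t then none else some (σ.sent w E t)

/-- The scheme achieves robust recovery against `M` unreliable clients: for every `M`-element set
`I` of clients, when arbitrary transmissions of the clients in `I` (and no others) are erased, each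
client outside `I` recovers every packet held by some client outside `I`. -/
def Robust (σ : CodingScheme X L A) (M : ℕ) : Prop :=
  ∀ I : Finset (Fin N), I.card = M →
    ∀ E : Fin N → Fin σ.T → Bool, (∀ i t, E i t = true → σ.sender t ∈ I) →
      ∀ w : Fin K → Fin L → A, ∀ i, i ∉ I → ∀ j, j ∉ I → ∀ x ∈ X j,
        σ.dec i (fun y => w y.1) (σ.received w E i) x = w x

/-- Every transmission is a fixed linear combination of the chunks of the packets held by its
sender. -/
def IsLinear {F : Type} [Field F] (σ : CodingScheme X L F) : Prop :=
  ∃ c : Fin σ.T → Fin K → Fin L → F, ∀ t own hist,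
    σ.enc t own hist = ∑ x : {x // x ∈ X (σ.sender t)}, ∑ l, c t x.1 l * own x l

/-- The number of transmissions of client `i`, where a transmission of the size of a packet counts
as one, so that a transmission of the size of a chunk counts as `1 / L`. -/
noncomputable def rate (σ : CodingScheme X L A) (i : Fin N) : ℝ :=
  ((Finset.univ.filter fun t => σ.sender t = i).card : ℝ) / L

end CodingScheme

/-- The total numbers of transmissions of the schemes that achieve robust recovery against `M`
unreliable clients, when each packet is divided into `L` chunks, over any finite alphabet with at
least two elements. -/
def robustTotals {N K : ℕ} (X : Fin N → Finset (Fin K)) (M L : ℕ) : Set ℝ :=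
  {s | ∃ (A : Type) (_ : Finite A) (_ : Nontrivial A) (σ : CodingScheme X L A),
    σ.Robust M ∧ s = ∑ i, σ.rate i}

/-- The same for linear schemes over finite fields. -/
def robustLinearTotals {N K : ℕ} (X : Fin N → Finset (Fin K)) (M L : ℕ) : Set ℝ :=
  {s | ∃ (F : Type) (_ : Field F) (_ : Finite F) (σ : CodingScheme X L F),
    σ.IsLinear ∧ σ.Robust M ∧ s = ∑ i, σ.rate i}

/-! ### The converse -/

/-! For each `L ≥ 1`, the feasible points with coordinates in the multiples of `1 / L` are exactly
the rate vectors of robust schemes, and linear schemes suffice.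

Converse (`card_commonRequired_mul_le`): erase everything sent by `I` and vary only the packets
missing to all clients outside `S ∪ I`. Such a client must then recover them from the broadcasts of
`S` alone, so `S` has at least as many slots as there are missing chunks.

Achievability: the constraints are Hall's condition for matching the chunks required by a client to
slots of reliable holders (`exists_matching`). A matching makes the determinant of the client's
decoding equations a nonzero polynomial in the coefficients. The product over all pairs of an
unreliable set and a reliable client is nonzero too, so one choice of coefficients over some prime
field serves them all.

For a fixed `L` the totals are multiples of `1 / L`, so a minimum exists. For arbitrary `L`, the
real program attains its optimum by compactness, and also at a rational point, whose denominators
supply `L`. -/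

theorem constraintBound_le_card {N K : ℕ} (X : Fin N → Finset (Fin K)) (M : ℕ)
    (S : Finset (Fin N)) : constraintBound X M S ≤ K :=
  Finset.sup_le fun I _ => (Finset.card_le_univ (commonRequired X S I)).trans (by simp)

namespace CodingScheme

variable {N K : ℕ} {X : Fin N → Finset (Fin K)} {L : ℕ} {A : Type}

/-- If all transmissions of the clients in `I` are erased, the content of the packets matters for
the remaining broadcasts only through the packets held outside `S ∪ I` and the broadcasts
of `S`. -/
theorem sent_eq_of_agree (σ : CodingScheme X L A) (S I : Finset (Fin N))
    (w w' : Fin K → Fin L → A) (hw : ∀ i, i ∉ S → i ∉ I → ∀ x ∈ X i, w x = w' x)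
    (hS : ∀ t, σ.sender t ∈ S → σ.sent w (fun _ t => decide (σ.sender t ∈ I)) t =
      σ.sent w' (fun _ t => decide (σ.sender t ∈ I)) t) :
    ∀ t, σ.sender t ∉ I → σ.sent w (fun _ t => decide (σ.sender t ∈ I)) t =
      σ.sent w' (fun _ t => decide (σ.sender t ∈ I)) t := by
  have key : ∀ m : ℕ, ∀ t : Fin σ.T, t.val = m → σ.sender t ∉ I →
      σ.sent w (fun _ t => decide (σ.sender t ∈ I)) t =
      σ.sent w' (fun _ t => decide (σ.sender t ∈ I)) t := by
    intro m
    induction m using Nat.strong_induction_on with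
    | _ m ih =>
      intro t ht hI
      by_cases hs : σ.sender t ∈ S
      · exact hS t hs
      · rw [sent, sent]
        congr 1
        · funext x
          exact hw _ hs hI x.1 x.2
        · funext s
          by_cases h : σ.sender ⟨s.val, s.isLt.trans t.isLt⟩ ∈ I
          · simp [h]
          · simp only [h, decide_false, Bool.false_eq_true, if_false]
            rw [ih s.val (ht ▸ s.isLt) ⟨s.val, s.isLt.trans t.isLt⟩ rfl h]
  exact fun t => key t.val t rfl

/-- With the other packets fixed, the content of the common required packets is determined by the
broadcasts of `S`, so comparing powers of `|A|` compares the exponents. -/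
theorem card_commonRequired_mul_le [Finite A] [Nontrivial A] (σ : CodingScheme X L A) {M : ℕ}
    (hσ : σ.Robust M) {S I : Finset (Fin N)} (hI : I.card = M) (hne : (Sᶜ \ I).Nonempty) :
    (commonRequired X S I).card * L ≤
      (Finset.univ.filter fun t => σ.sender t ∈ S).card := by
  classical
  have := Fintype.ofFinite A
  obtain ⟨a₀⟩ : Nonempty A := inferInstance
  obtain ⟨i, hi⟩ := hne
  have hiI : i ∉ I := (Finset.mem_sdiff.1 hi).2
  set C := commonRequired X S I with hC
  let E : Fin N → Fin σ.T → Bool := fun _ t => decide (σ.sender t ∈ I)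
  let ext : ({x // x ∈ C} × Fin L → A) → Fin K → Fin L → A :=
    fun u x l => if h : x ∈ C then u (⟨x, h⟩, l) else a₀
  let g : ({x // x ∈ C} × Fin L → A) → ({t // σ.sender t ∈ S} → A) :=
    fun u t => σ.sent (ext u) E t.1
  have hg : Function.Injective g := by
    intro u u' huu
    -- A client outside `S ∪ I` holds no packet of `C`, so it only sees the constant filling `a₀`.
    have hout : ∀ j, j ∉ S → j ∉ I → ∀ x ∈ X j, ext u x = ext u' x := by
      intro j hjS hjI x hx
      have hxC : x ∉ C := fun h => by
        have h1 := (Finset.mem_filter.1 h).2 j (by simp [hjS, hjI])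
        exact (Finset.mem_sdiff.1 h1).2 hx
      funext l
      simp [ext, hxC]
    have hsent := σ.sent_eq_of_agree S I (ext u) (ext u') hout
      (fun t ht => congrFun huu ⟨t, ht⟩)
    have hrec : σ.received (ext u) E i = σ.received (ext u') E i := by
      funext t
      by_cases h : σ.sender t ∈ I
      · simp [received, E, h]
      · simp only [received, E, h, decide_false, Bool.false_eq_true, if_false]
        rw [hsent t h]
    have hown : (fun y : {x // x ∈ X i} => ext u y.1) = fun y => ext u' y.1 := by
      funext y
      exact hout i (by simpa using (Finset.mem_sdiff.1 hi).1) hiI y.1 y.2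
    funext p
    obtain ⟨⟨x, hx⟩, l⟩ := p
    have hxr := (Finset.mem_filter.1 hx).2 i hi
    obtain ⟨j, hj, hxj⟩ := Finset.mem_biUnion.1 (Finset.mem_sdiff.1 hxr).1
    have hE : ∀ i t, E i t = true → σ.sender t ∈ I := fun _ t h => of_decide_eq_true h
    have e1 := hσ I hI E hE (ext u) i hiI j (by simpa using hj) x hxj
    have e2 := hσ I hI E hE (ext u') i hiI j (by simpa using hj) x hxj
    rw [hrec, hown, e2] at e1
    have := congrFun e1 l
    simpa [ext, hx] using this.symm
  have hcard := Fintype.card_le_of_injective g hg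
  rw [Fintype.card_fun, Fintype.card_fun] at hcard
  have := (Nat.pow_le_pow_iff_right (Fintype.one_lt_card (α := A))).1 hcard
  simpa [Fintype.card_subtype] using this

theorem sum_card_sender (σ : CodingScheme X L A) (S : Finset (Fin N)) :
    (Finset.univ.filter fun t => σ.sender t ∈ S).card =
      ∑ i ∈ S, (Finset.univ.filter fun t => σ.sender t = i).card := by
  rw [Finset.card_eq_sum_card_fiberwise (f := σ.sender) (t := S)
    (fun t ht => by simpa using ht)]
  refine Finset.sum_congr rfl fun i hi => ?_
  congr 1
  ext t
  simp only [Finset.mem_filter, Finset.mem_univ, true_and]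
  exact ⟨fun h => h.2, fun h => ⟨h ▸ hi, h⟩⟩

/-- The rates of a robust scheme satisfy the constraints of the linear program. -/
theorem lpFeasible_rate [Finite A] [Nontrivial A] (σ : CodingScheme X L A) {M : ℕ}
    (hL : 1 ≤ L) (hσ : σ.Robust M) : LPFeasible X M σ.rate := by
  refine ⟨fun i => by unfold rate; positivity, fun S h1 h2 => ?_⟩
  have hLpos : (0 : ℝ) < L := by exact_mod_cast hL
  have hb : constraintBound X M S * L ≤
      (Finset.univ.filter fun t => σ.sender t ∈ S).card := by
    rw [← Nat.le_div_iff_mul_le hL]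
    refine Finset.sup_le fun I hI => ?_
    rw [Nat.le_div_iff_mul_le hL]
    obtain ⟨hIS, hIM⟩ := Finset.mem_powersetCard.1 hI
    refine σ.card_commonRequired_mul_le hσ hIM ?_
    -- Since `1 ≤ |S| ≤ N - M - 1`, the subtraction is not truncated and some client lies outside `S
    -- ∪ I`.
    rw [← Finset.card_pos, Finset.card_sdiff_of_subset hIS, Finset.card_compl, Fintype.card_fin,
      hIM]
    omega
  unfold rate
  rw [← Finset.sum_div, le_div_iff₀ hLpos]
  rw [σ.sum_card_sender] at hb
  exact_mod_cast hb

end CodingScheme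

theorem robustTotals_subset_lpValuesDiv {N K : ℕ} (X : Fin N → Finset (Fin K)) (M : ℕ) {L : ℕ}
    (hL : 1 ≤ L) : robustTotals X M L ⊆ lpValuesDiv X M L := by
  rintro s ⟨A, _, _, σ, hσ, rfl⟩
  exact ⟨σ.rate, σ.lpFeasible_rate hL hσ, fun i => ⟨_, rfl⟩, rfl⟩

theorem robustLinearTotals_subset_robustTotals {N K : ℕ} (X : Fin N → Finset (Fin K)) (M L : ℕ) :
    robustLinearTotals X M L ⊆ robustTotals X M L := by
  rintro s ⟨F, _, hF, σ, -, hσ, rfl⟩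
  exact ⟨F, hF, inferInstance, σ, hσ, rfl⟩

/-! ### Achievability -/

/-- A nonzero integer polynomial has a non-root over some prime field. -/
theorem MvPolynomial.exists_prime_aeval_ne_zero {τ : Type*} (P : MvPolynomial τ ℤ) (hP : P ≠ 0) :
    ∃ p : ℕ, p.Prime ∧ ∃ c : τ → ZMod p, aeval c P ≠ 0 := by
  obtain ⟨z, hz⟩ : ∃ z : τ → ℤ, eval z P ≠ 0 := by
    by_contra! h
    exact hP (MvPolynomial.funext fun z => by simpa using h z)
  -- A prime larger than the absolute value of a nonzero integer does not divide it.
  obtain ⟨p, hp, hpr⟩ := Nat.exists_infinite_primes ((eval z P).natAbs + 1)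
  refine ⟨p, hpr, fun i => (z i : ZMod p), ?_⟩
  have h1 : aeval (fun i => (z i : ZMod p)) P = ((eval z P : ℤ) : ZMod p) := by
    have := MvPolynomial.eval₂_comp_left (Int.castRingHom (ZMod p)) (RingHom.id ℤ) z P
    rw [aeval_def, eval, coe_eval₂Hom]
    simpa [Function.comp_def] using this.symm
  rw [h1, Ne, ZMod.intCast_zmod_eq_zero_iff_dvd, Int.natCast_dvd]
  intro hd
  have := Nat.le_of_dvd (Int.natAbs_pos.2 hz) hd
  omega

section Achievability

variable {N K : ℕ} (X : Fin N → Finset (Fin K)) (M L : ℕ)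

/-- By the Hall marriage theorem, feasibility lets the chunks required by `i` be matched with slots of
reliable clients that hold them. -/
theorem exists_matching {T : ℕ} (sender : Fin T → Fin N) (hL : 1 ≤ L)
    (hr : LPFeasible X M fun i => ((Finset.univ.filter fun t => sender t = i).card : ℝ) / L)
    {I : Finset (Fin N)} (hI : I.card = M) {i : Fin N} (hi : i ∉ I) :
    ∃ f : {x // x ∈ requiredPackets X I i} × Fin L → Fin T, Function.Injective f ∧
      ∀ p, sender (f p) ∉ I ∧ p.1.1 ∈ X (sender (f p)) := by
  classical
  let t : {x // x ∈ requiredPackets X I i} × Fin L → Finset (Fin T) := fun p =>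
    Finset.univ.filter fun s => sender s ∉ I ∧ p.1.1 ∈ X (sender s)
  suffices h : ∀ Q : Finset ({x // x ∈ requiredPackets X I i} × Fin L),
      Q.card ≤ (Q.biUnion t).card by
    obtain ⟨f, hf, hft⟩ := (Finset.all_card_le_biUnion_card_iff_exists_injective t).1 h
    exact ⟨f, hf, fun p => by simpa [t] using hft p⟩
  intro Q
  -- The empty case is separate because the program has no constraint for `S = ∅`.
  rcases Q.eq_empty_or_nonempty with rfl | ⟨q, hq⟩
  · simp
  let Y : Finset (Fin K) := Q.image fun p => p.1.1
  -- The slots available to `Q` are exactly those of `S`, and every reliable client outside `S`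
  -- lacks all of `Y`; hence the constraint of `S` is Hall's condition for `Q`.
  let S : Finset (Fin N) := Finset.univ.filter fun j => j ∉ I ∧ ∃ x ∈ Y, x ∈ X j
  have hQY : Q.card ≤ Y.card * L := by
    have : (Q.image fun p => (p.1.1, p.2)).card = Q.card :=
      Finset.card_image_of_injective _ (by
        rintro ⟨⟨a, _⟩, b⟩ ⟨⟨a', _⟩, b'⟩ h
        simpa using h)
    rw [← this]
    refine (Finset.card_le_card (t := Y ×ˢ (Finset.univ : Finset (Fin L))) ?_).trans (by simp)
    intro z hz
    obtain ⟨p, hp, rfl⟩ := Finset.mem_image.1 hz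
    exact Finset.mem_product.2 ⟨Finset.mem_image.2 ⟨p, hp, rfl⟩, Finset.mem_univ _⟩
  have hYreq : ∀ x ∈ Y, x ∈ requiredPackets X I i := by
    intro x hx
    obtain ⟨p, -, rfl⟩ := Finset.mem_image.1 hx
    exact p.1.2
  have hYhold : ∀ x ∈ Y, ∃ j ∈ Iᶜ, x ∈ X j := fun x hx =>
    Finset.mem_biUnion.1 (Finset.mem_sdiff.1 (hYreq x hx)).1
  have hiS : i ∉ S := by
    intro h
    obtain ⟨-, -, x, hx, hxi⟩ := Finset.mem_filter.1 h
    exact (Finset.mem_sdiff.1 (hYreq x hx)).2 hxi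
  have hSI : Disjoint S I := Finset.disjoint_left.2 fun j hj => (Finset.mem_filter.1 hj).2.1
  have hSpos : 1 ≤ S.card := by
    have hqY : q.1.1 ∈ Y := Finset.mem_image.2 ⟨q, hq, rfl⟩
    obtain ⟨j, hj, hxj⟩ := hYhold _ hqY
    exact Finset.card_pos.2
      ⟨j, Finset.mem_filter.2 ⟨Finset.mem_univ _, by simpa using hj, _, hqY, hxj⟩⟩
  -- Client `i` lies outside the disjoint union of `S` and `I`, which accounts for the `- 1`.
  have hSle : S.card ≤ N - M - 1 := by
    have h1 : (insert i (S ∪ I)).card ≤ N := by simpa using Finset.card_le_univ (insert i (S ∪ I))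
    rw [Finset.card_insert_of_notMem (by simp [hiS, hi]), Finset.card_union_of_disjoint hSI,
      hI] at h1
    omega
  have hYc : Y ⊆ commonRequired X S I := by
    intro x hx
    refine Finset.mem_filter.2 ⟨Finset.mem_univ _, fun j hj => ?_⟩
    obtain ⟨hjS, hjI⟩ := Finset.mem_sdiff.1 hj
    refine Finset.mem_sdiff.2 ⟨Finset.mem_biUnion.2 (hYhold x hx), fun hxj => ?_⟩
    exact Finset.mem_compl.1 hjS (Finset.mem_filter.2 ⟨Finset.mem_univ _, hjI, x, hx, hxj⟩)
  have hYb : Y.card ≤ constraintBound X M S :=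
    (Finset.card_le_card hYc).trans <| Finset.le_sup (f := fun I => (commonRequired X S I).card)
      (Finset.mem_powersetCard.2
        ⟨fun j hj => Finset.mem_compl.2 (Finset.disjoint_right.1 hSI hj), hI⟩)
  have hLpos : (0 : ℝ) < L := by exact_mod_cast hL
  have hfeas := hr.2 S hSpos hSle
  rw [← Finset.sum_div, le_div_iff₀ hLpos] at hfeas
  have hcount : constraintBound X M S * L ≤
      ∑ j ∈ S, (Finset.univ.filter fun s => sender s = j).card := by exact_mod_cast hfeas
  have hU : (Q.biUnion t).card = ∑ j ∈ S, (Finset.univ.filter fun s => sender s = j).card := by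
    have hUeq : Q.biUnion t = Finset.univ.filter fun s => sender s ∈ S := by
      ext s
      simp only [Finset.mem_biUnion, Finset.mem_filter, Finset.mem_univ, true_and, t, S, Y,
        Finset.mem_image]
      constructor
      · rintro ⟨p, hp, h1, h2⟩
        exact ⟨h1, _, ⟨p, hp, rfl⟩, h2⟩
      · rintro ⟨h1, _, ⟨p, hp, rfl⟩, h2⟩
        exact ⟨p, hp, h1, h2⟩
    rw [hUeq, Finset.card_eq_sum_card_fiberwise (f := sender) (t := S)
      (fun s hs => by simpa using hs)]
    refine Finset.sum_congr rfl fun j hj => ?_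
    congr 1
    ext s
    simp only [Finset.mem_filter, Finset.mem_univ, true_and]
    exact ⟨fun h => h.2, fun h => ⟨h ▸ hj, h⟩⟩
  rw [hU]
  exact hQY.trans ((Nat.mul_le_mul_right L hYb).trans hcount)

/-- The linear combination of chunks with coefficients `c` that is broadcast in slot `t`. -/
def linearBroadcast {X : Fin N → Finset (Fin K)} {L T : ℕ} {F : Type} [Field F]
    (sender : Fin T → Fin N) (c : Fin T → Fin K → Fin L → F) (t : Fin T)
    (own : {x // x ∈ X (sender t)} → Fin L → F) : F :=
  ∑ x : {x // x ∈ X (sender t)}, ∑ l, c t x.1 l * own x l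

open Classical in
/-- The scheme that broadcasts fixed linear combinations; a client decodes to any content
of the packets that is consistent with what it knows. -/
noncomputable def linearScheme {T : ℕ} {F : Type} [Field F] (sender : Fin T → Fin N)
    (c : Fin T → Fin K → Fin L → F) : CodingScheme X L F where
  T := T
  sender := sender
  enc t own _ := linearBroadcast sender c t own
  dec i own rec :=
    if h : ∃ w : Fin K → Fin L → F, (fun y : {x // x ∈ X i} => w y.1) = own ∧
        ∀ t a, rec t = some a → linearBroadcast (X := X) sender c t (fun x => w x.1) = a
    then h.choose else 0

/-- The square matrix of the equations for the packets required by `i` that are matched by `f`. -/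
def decodingMatrix {T : ℕ} {R : Type*} [CommRing R] (sender : Fin T → Fin N)
    (c : Fin T × Fin K × Fin L → R) {I : Finset (Fin N)} {i : Fin N}
    (f : {x // x ∈ requiredPackets X I i} × Fin L → Fin T) :
    Matrix ({x // x ∈ requiredPackets X I i} × Fin L)
      ({x // x ∈ requiredPackets X I i} × Fin L) R :=
  Matrix.of fun p q => if q.1.1 ∈ X (sender (f p)) then c (f p, q.1.1, q.2) else 0

/-- Setting the matched variables to 1 and all others to 0 turns the matrix into the identity,
because `f` is injective. -/
theorem det_decodingMatrix_X_ne_zero {T : ℕ} (sender : Fin T → Fin N) {I : Finset (Fin N)}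
    {i : Fin N} (f : {x // x ∈ requiredPackets X I i} × Fin L → Fin T)
    (hf : Function.Injective f) (hfX : ∀ p, p.1.1 ∈ X (sender (f p))) :
    (decodingMatrix X L sender (fun v => (MvPolynomial.X v : MvPolynomial _ ℤ)) f).det ≠ 0 := by
  classical
  intro h0
  let z : Fin T × Fin K × Fin L → ℤ := fun v =>
    if ∃ p, f p = v.1 ∧ p.1.1 = v.2.1 ∧ p.2 = v.2.2 then 1 else 0
  have h1 := congrArg (MvPolynomial.eval z) h0
  rw [RingHom.map_det, map_zero] at h1
  have h2 : (MvPolynomial.eval z).mapMatrix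
      (decodingMatrix X L sender (fun v => (MvPolynomial.X v : MvPolynomial _ ℤ)) f) = 1 := by
    ext p q
    simp only [decodingMatrix, RingHom.mapMatrix_apply, Matrix.map_apply, Matrix.of_apply,
      apply_ite (MvPolynomial.eval z), MvPolynomial.eval_X, map_zero]
    by_cases hpq : p = q
    · subst hpq
      rw [if_pos (hfX p), Matrix.one_apply_eq]
      exact if_pos ⟨p, rfl, rfl, rfl⟩
    · rw [Matrix.one_apply_ne hpq]
      have : z (f p, q.1.1, q.2) = 0 := by
        refine if_neg ?_
        rintro ⟨p', e1, e2, e3⟩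
        refine hpq ?_
        rw [← hf e1]
        exact Prod.ext (Subtype.ext e2) e3
      rw [this, ite_self]
  rw [h2, Matrix.det_one] at h1
  exact one_ne_zero h1

/-- If the decoding matrix is invertible, then reliable broadcasts determine the packets
required by `i`. -/
theorem eq_of_linearBroadcast_eq {T : ℕ} {F : Type} [Field F] (sender : Fin T → Fin N)
    (c : Fin T × Fin K × Fin L → F) {I : Finset (Fin N)} {i : Fin N}
    (f : {x // x ∈ requiredPackets X I i} × Fin L → Fin T)
    (hfI : ∀ p, sender (f p) ∉ I) (hdet : (decodingMatrix X L sender c f).det ≠ 0)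
    (w w' : Fin K → Fin L → F) (hown : ∀ x ∈ X i, w x = w' x)
    (hb : ∀ t, sender t ∉ I →
      linearBroadcast (X := X) sender (fun t x l => c (t, x, l)) t (fun x => w x.1) =
      linearBroadcast (X := X) sender (fun t x l => c (t, x, l)) t (fun x => w' x.1))
    {j : Fin N} (hj : j ∉ I) {x : Fin K} (hx : x ∈ X j) : w x = w' x := by
  classical
  by_cases hxi : x ∈ X i
  · exact hown x hxi
  have hxr : x ∈ requiredPackets X I i :=
    Finset.mem_sdiff.2 ⟨Finset.mem_biUnion.2 ⟨j, by simpa using hj, hx⟩, hxi⟩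
  let d : {x // x ∈ requiredPackets X I i} × Fin L → F := fun q => w q.1.1 q.2 - w' q.1.1 q.2
  have hd : (decodingMatrix X L sender c f).mulVec d = 0 := by
    funext p
    have h1 := sub_eq_zero.2 (hb (f p) (hfI p))
    simp only [linearBroadcast, ← Finset.sum_sub_distrib, ← mul_sub] at h1
    rw [Finset.sum_coe_sort (X (sender (f p)))
      (fun x => ∑ l, c (f p, x, l) * (w x l - w' x l))] at h1
    rw [Pi.zero_apply, ← h1]
    simp only [Matrix.mulVec, dotProduct, decodingMatrix, Matrix.of_apply, d]
    rw [Fintype.sum_prod_type, Finset.sum_coe_sort (requiredPackets X I i)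
      (fun x => ∑ l, (if x ∈ X (sender (f p)) then c (f p, x, l) else 0) * (w x l - w' x l))]
    have e1 : ∀ x, (∑ l, (if x ∈ X (sender (f p)) then c (f p, x, l) else 0) *
        (w x l - w' x l)) =
        if x ∈ X (sender (f p)) then ∑ l, c (f p, x, l) * (w x l - w' x l) else 0 := by
      intro x
      split_ifs <;> simp
    simp only [e1]
    rw [← Finset.sum_filter]
    -- The sender is reliable, so each packet it holds that `i` does not require is already held by
    -- `i`, and there the difference vanishes.
    refine Finset.sum_subset (fun y hy => (Finset.mem_filter.1 hy).2) fun y hy hy' => ?_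
    have hyi : y ∈ X i := by
      by_contra hyi
      exact hy' (Finset.mem_filter.2 ⟨Finset.mem_sdiff.2
        ⟨Finset.mem_biUnion.2 ⟨_, by simpa using hfI p, hy⟩, hyi⟩, hy⟩)
    simp [hown y hyi]
  have hd0 := Matrix.eq_zero_of_mulVec_eq_zero hdet hd
  funext l
  exact sub_eq_zero.1 (congrFun hd0 (⟨x, hxr⟩, l))

theorem exists_linearScheme_robust {T : ℕ} (sender : Fin T → Fin N) (hL : 1 ≤ L)
    (hr : LPFeasible X M fun i => ((Finset.univ.filter fun t => sender t = i).card : ℝ) / L) :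
    ∃ (F : Type) (_ : Field F) (_ : Finite F) (c : Fin T → Fin K → Fin L → F),
      (linearScheme X L sender c).Robust M := by
  classical
  let κ := {k : Finset (Fin N) × Fin N // k.1.card = M ∧ k.2 ∉ k.1}
  choose f hfinj hf using fun k : κ => exists_matching X M L sender hL hr k.2.1 k.2.2
  have hP : ∏ k : κ,
      (decodingMatrix X L sender (fun v => (MvPolynomial.X v : MvPolynomial _ ℤ)) (f k)).det ≠ 0 :=
    Finset.prod_ne_zero_iff.2 fun k _ =>
      det_decodingMatrix_X_ne_zero X L sender (f k) (hfinj k) fun p => (hf k p).2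
  obtain ⟨p, hp, c, hc⟩ := MvPolynomial.exists_prime_aeval_ne_zero _ hP
  have : Fact p.Prime := ⟨hp⟩
  rw [map_prod, Finset.prod_ne_zero_iff] at hc
  refine ⟨ZMod p, inferInstance, inferInstance, fun t x l => c (t, x, l), ?_⟩
  set σ := linearScheme X L sender fun t x l => c (t, x, l)
  intro I hI E hE w i hi j hj x hx
  let k : κ := ⟨(I, i), hI, hi⟩
  have hdet : (decodingMatrix X L sender c (f k)).det ≠ 0 := by
    have h1 := hc k (Finset.mem_univ _)
    rw [AlgHom.map_det] at h1
    convert h1 using 2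
    ext a b
    simp [decodingMatrix, apply_ite (MvPolynomial.aeval c)]
  -- The encoders ignore what they receive, so erasures do not alter the broadcasts.
  have hsent : ∀ t, σ.sent w E t =
      linearBroadcast (X := X) sender (fun t x l => c (t, x, l)) t (fun x => w x.1) := by
    intro t
    rw [CodingScheme.sent]
    rfl
  -- The true content is consistent with everything received, so the decoder never falls back on its
  -- default value 0.
  have hex : ∃ w' : Fin K → Fin L → ZMod p,
      (fun y : {x // x ∈ X i} => w' y.1) = (fun y => w y.1) ∧
        ∀ t a, σ.received w E i t = some a →
          linearBroadcast (X := X) sender (fun t x l => c (t, x, l)) t (fun x => w' x.1) = a := by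
    refine ⟨w, rfl, fun t a h => ?_⟩
    rw [CodingScheme.received] at h
    split_ifs at h
    rw [← hsent t]
    exact Option.some.inj h
  have hdec : σ.dec i (fun y => w y.1) (σ.received w E i) = hex.choose := dif_pos hex
  rw [hdec]
  refine eq_of_linearBroadcast_eq X L sender c (f k) (fun p => (hf k p).1) hdet _ _
    (fun y hy => congrFun hex.choose_spec.1 ⟨y, hy⟩) (fun t ht => ?_) hj hx
  refine hex.choose_spec.2 t _ ?_
  have : E i t ≠ true := fun h => ht (hE i t h)
  exact (if_neg this).trans (congrArg some (hsent t))

theorem lpValuesDiv_subset_robustLinearTotals (hL : 1 ≤ L) :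
    lpValuesDiv X M L ⊆ robustLinearTotals X M L := by
  classical
  rintro s ⟨r, hr, hn, rfl⟩
  choose n hn using hn
  -- Client `i` is given `n i` slots; their order is irrelevant.
  let e := (Fintype.equivFin (Σ i, Fin (n i))).symm
  let sender : Fin (Fintype.card (Σ i, Fin (n i))) → Fin N := fun t => (e t).1
  have hcard : ∀ i, (Finset.univ.filter fun t => sender t = i).card = n i := by
    intro i
    rw [← Fintype.card_subtype, Fintype.card_congr
      ((e.subtypeEquiv fun _ => Iff.rfl).trans (Equiv.sigmaSubtype i))]
    simp
  have hrate : r = fun i => ((Finset.univ.filter fun t => sender t = i).card : ℝ) / L := by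
    funext i
    rw [hn, hcard]
  rw [hrate] at hr
  obtain ⟨F, hF, hfin, c, hc⟩ := exists_linearScheme_robust X M L sender hL hr
  refine ⟨F, hF, hfin, linearScheme X L sender c, ⟨c, fun _ _ _ => rfl⟩, hc, ?_⟩
  rw [hrate]
  rfl

end Achievability

/-! ### The optimum of the linear program -/

/-- Finitely many reals can be approximated by rationals in a `ℚ`-linear way. -/
theorem exists_rat_linearMap_near {ι : Type*} [Finite ι] (r : ι → ℝ) {ε : ℝ} (hε : 0 < ε) :
    ∃ φ : ℝ →ₗ[ℚ] ℚ, φ 1 = 1 ∧ ∀ i, |(φ (r i) : ℝ) - r i| < ε := by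
  classical
  have := Fintype.ofFinite ι
  have hli : LinearIndepOn ℚ id ({1} : Set ℝ) := LinearIndepOn.singleton one_ne_zero
  -- Extend 1 to a basis of `ℝ` over `ℚ`; `φ` will fix 1 and move every other basis vector to a
  -- nearby rational.
  let b := Module.Basis.extend hli
  have h1 : (1 : ℝ) ∈ hli.extend (Set.subset_univ _) := hli.subset_extend _ rfl
  -- `C` exceeds the sum of the absolute coordinates of each `r i`, so an error below `ε / C` on
  -- basis vectors yields one below `ε`; the summand 1 also keeps `C` positive.
  let C : ℝ := 1 + ∑ i, ∑ k ∈ (b.repr (r i)).support, |((b.repr (r i) k : ℚ) : ℝ)|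
  have hC : 0 < C := by positivity
  have hq : ∀ k, ∃ q : ℚ, |(q : ℝ) - b k| < ε / C ∧ (k = ⟨1, h1⟩ → q = 1) := by
    intro k
    by_cases hk : k = ⟨1, h1⟩
    · refine ⟨1, ?_, fun _ => rfl⟩
      have : b k = 1 := by rw [hk, Module.Basis.extend_apply_self]
      rw [this]
      simpa using div_pos hε hC
    · obtain ⟨q, h⟩ := Rat.denseRange_cast.exists_dist_lt (b k) (div_pos hε hC)
      refine ⟨q, ?_, fun h => absurd h hk⟩
      rwa [dist_comm, Real.dist_eq] at h
  choose q hq hq1 using hq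
  refine ⟨b.constr ℚ q, ?_, fun i => ?_⟩
  · have : b ⟨1, h1⟩ = 1 := Module.Basis.extend_apply_self hli _
    calc b.constr ℚ q 1 = b.constr ℚ q (b ⟨1, h1⟩) := by rw [this]
      _ = 1 := by rw [Module.Basis.constr_basis, hq1 _ rfl]
  · have e1 : ((b.constr ℚ q (r i) : ℚ) : ℝ) =
        ∑ k ∈ (b.repr (r i)).support, ((b.repr (r i) k : ℚ) : ℝ) * q k := by
      rw [Module.Basis.constr_apply, Finsupp.sum]
      push_cast
      simp
    have e2 : r i = ∑ k ∈ (b.repr (r i)).support, ((b.repr (r i) k : ℚ) : ℝ) * b k := by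
      conv_lhs => rw [← b.linearCombination_repr (r i), Finsupp.linearCombination_apply,
        Finsupp.sum]
      simp [Rat.smul_def]
    have e3 : ((b.constr ℚ q (r i) : ℚ) : ℝ) - r i =
        ∑ k ∈ (b.repr (r i)).support, ((b.repr (r i) k : ℚ) : ℝ) * (q k - b k) := by
      simp only [mul_sub]
      rw [Finset.sum_sub_distrib, ← e1, ← e2]
    rw [e3]
    calc _ ≤ ∑ k ∈ (b.repr (r i)).support, |((b.repr (r i) k : ℚ) : ℝ) * (q k - b k)| :=
          Finset.abs_sum_le_sum_abs _ _
      _ ≤ ∑ k ∈ (b.repr (r i)).support, |((b.repr (r i) k : ℚ) : ℝ)| * (ε / C) := by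
          refine Finset.sum_le_sum fun k _ => ?_
          rw [abs_mul]
          exact mul_le_mul_of_nonneg_left (hq k).le (abs_nonneg _)
      _ = (∑ k ∈ (b.repr (r i)).support, |((b.repr (r i) k : ℚ) : ℝ)|) * (ε / C) := by
          rw [Finset.sum_mul]
      _ < C * (ε / C) := by
          refine mul_lt_mul_of_pos_right ?_ (div_pos hε hC)
          have := Finset.single_le_sum
            (f := fun i => ∑ k ∈ (b.repr (r i)).support, |((b.repr (r i) k : ℚ) : ℝ)|)
            (fun i _ => Finset.sum_nonneg fun _ _ => abs_nonneg _) (Finset.mem_univ i)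
          simp only [C]
          linarith
      _ = ε := mul_div_cancel₀ _ (ne_of_gt hC)

/-- A finite system of linear inequalities with rational data is satisfied by rational points
near any real solution, and by their reflections. -/
theorem exists_rat_solution_near {ι κ : Type*} [Fintype ι] [Finite κ] (a : κ → ι → ℚ)
    (β : κ → ℚ) (r : ι → ℝ) (hr : ∀ k, (β k : ℝ) ≤ ∑ i, a k i * r i) :
    ∃ q : ι → ℚ, (∀ k, (β k : ℝ) ≤ ∑ i, a k i * (q i : ℝ)) ∧
      ∀ k, (β k : ℝ) ≤ ∑ i, a k i * (2 * r i - q i) := by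
  classical
  have := Fintype.ofFinite κ
  -- Choose `ε` no larger than the slack of any non-tight inequality.
  have hgap : ∃ ε : ℝ, 0 < ε ∧ ∀ k, (β k : ℝ) < ∑ i, a k i * r i →
      ε ≤ ∑ i, a k i * r i - β k := by
    have hev : ∀ᶠ ε : ℝ in nhdsWithin 0 (Set.Ioi 0), ∀ k, (β k : ℝ) < ∑ i, a k i * r i →
        ε ≤ ∑ i, a k i * r i - β k := by
      rw [Filter.eventually_all]
      intro k
      by_cases hk : (β k : ℝ) < ∑ i, a k i * r i
      · filter_upwards [nhdsWithin_le_nhds (eventually_le_nhds (sub_pos.2 hk))] with ε h _ using h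
      · exact Filter.Eventually.of_forall fun _ h => absurd h hk
    obtain ⟨ε, h, hε⟩ := (hev.and self_mem_nhdsWithin).exists
    exact ⟨ε, hε, h⟩
  obtain ⟨ε, hε, hgap⟩ := hgap
  obtain ⟨φ, h1, hφ⟩ := exists_rat_linearMap_near
    (fun z : κ => ∑ i, (a z i : ℝ) * r i) hε
  have hmap : ∀ k, (φ (∑ i, (a k i : ℝ) * r i) : ℝ) = ∑ i, (a k i : ℝ) * (φ (r i) : ℝ) := by
    intro k
    have : ∀ i, (a k i : ℝ) * r i = a k i • r i := fun i => (Rat.smul_def _ _).symm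
    simp only [this, map_sum, map_smul]
    push_cast
    simp
  have hβ : ∀ k, φ (β k : ℝ) = β k := by
    intro k
    have : (β k : ℝ) = β k • (1 : ℝ) := by rw [Rat.smul_def, mul_one]
    rw [this, map_smul, h1, smul_eq_mul, mul_one]
  have hclose : ∀ k, (β k : ℝ) ≤ ∑ i, (a k i : ℝ) * (φ (r i) : ℝ) ∧
      (β k : ℝ) ≤ ∑ i, (a k i : ℝ) * (2 * r i - φ (r i)) := by
    intro k
    have e : ∑ i, (a k i : ℝ) * (2 * r i - φ (r i)) =
        2 * (∑ i, (a k i : ℝ) * r i) - ∑ i, (a k i : ℝ) * (φ (r i) : ℝ) := by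
      rw [Finset.mul_sum, ← Finset.sum_sub_distrib]
      exact Finset.sum_congr rfl fun i _ => by ring
    rw [e, ← hmap]
    -- Tight inequalities stay tight because `φ` is `ℚ`-linear and fixes rationals; the others move
    -- by less than their slack, in either direction.
    rcases (hr k).eq_or_lt with h | h
    · rw [← h, hβ]
      constructor <;> linarith
    · have h2 := abs_lt.1 (hφ k)
      have h3 := hgap k h
      constructor <;> linarith [h2.1, h2.2]
  exact ⟨fun i => φ (r i), fun k => (hclose k).1, fun k => (hclose k).2⟩

section LinearProgram

variable {N K : ℕ} (X : Fin N → Finset (Fin K)) (M : ℕ)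

theorem lpFeasible_const : LPFeasible X M fun _ => (K : ℝ) := by
  refine ⟨fun _ => Nat.cast_nonneg _, fun S hS _ => ?_⟩
  have h : constraintBound X M S ≤ S.card * K :=
    (constraintBound_le_card X M S).trans (Nat.le_mul_of_pos_left K hS)
  simpa using (by exact_mod_cast h : (constraintBound X M S : ℝ) ≤ S.card * K)

/-- The constant point `K` has objective `N * K`, so a nonnegative point with a coordinate above `N
* K` cannot be better. Minimizing over a compact box is therefore enough. -/
theorem exists_isLeast_lpValues : ∃ v, IsLeast (lpValues X M) v := by
  let Fs : Set (Fin N → ℝ) := {r | LPFeasible X M r}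
  have hclosed : IsClosed Fs := by
    have : Fs = (⋂ i, {r | 0 ≤ r i}) ∩ ⋂ S : Finset (Fin N), ⋂ _ : 1 ≤ S.card,
        ⋂ _ : S.card ≤ N - M - 1, {r | (constraintBound X M S : ℝ) ≤ ∑ i ∈ S, r i} := by
      ext r
      simp [Fs, LPFeasible]
    rw [this]
    refine (isClosed_iInter fun i => isClosed_le continuous_const (continuous_apply i)).inter ?_
    refine isClosed_iInter fun S => isClosed_iInter fun _ => isClosed_iInter fun _ => ?_
    exact isClosed_le continuous_const (by fun_prop)
  have hcomp : IsCompact (Fs ∩ Set.Icc (fun _ => 0) fun _ => (N : ℝ) * K) :=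
    isCompact_Icc.inter_left hclosed
  have hmem : (fun _ => (K : ℝ)) ∈ Fs ∩ Set.Icc (fun _ : Fin N => (0 : ℝ)) fun _ => (N : ℝ) * K := by
    refine ⟨lpFeasible_const X M, fun _ => Nat.cast_nonneg _, fun i => ?_⟩
    have : K ≤ N * K := Nat.le_mul_of_pos_left K i.pos
    show (K : ℝ) ≤ N * K
    exact_mod_cast this
  obtain ⟨r, hr, hmin⟩ := hcomp.exists_isMinOn ⟨_, hmem⟩
    (f := fun r : Fin N → ℝ => ∑ i, r i) (by fun_prop)
  refine ⟨∑ i, r i, ⟨r, hr.1, rfl⟩, ?_⟩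
  rintro s ⟨r', hr', rfl⟩
  by_cases h : r' ∈ Set.Icc (fun _ : Fin N => (0 : ℝ)) fun _ => (N : ℝ) * K
  · exact hmin ⟨hr', h⟩
  · have h1 : ∃ i, (N : ℝ) * K < r' i := by
      by_contra! h1
      exact h ⟨hr'.1, h1⟩
    obtain ⟨i, hi⟩ := h1
    have h2 : ∑ i, r i ≤ ∑ _i : Fin N, (K : ℝ) := hmin hmem
    have h3 := Finset.single_le_sum (f := r') (fun j _ => hr'.1 j) (Finset.mem_univ i)
    simp only [Finset.sum_const, Finset.card_univ, Fintype.card_fin, nsmul_eq_mul] at h2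
    linarith

/-- The linear program has a rational optimal point. -/
theorem exists_mem_lpValuesDiv_of_isLeast {v : ℝ} (hv : IsLeast (lpValues X M) v) :
    ∃ L : ℕ, 1 ≤ L ∧ v ∈ lpValuesDiv X M L := by
  classical
  obtain ⟨⟨r, hr, rfl⟩, hmin⟩ := hv
  let κ := Fin N ⊕ {S : Finset (Fin N) // 1 ≤ S.card ∧ S.card ≤ N - M - 1}
  let a : κ → Fin N → ℚ := Sum.elim (fun i j => if j = i then 1 else 0)
    (fun S j => if j ∈ S.1 then 1 else 0)
  let β : κ → ℚ := Sum.elim (fun _ => 0) (fun S => constraintBound X M S.1)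
  have hfeas : ∀ s : Fin N → ℝ, LPFeasible X M s ↔ ∀ k, (β k : ℝ) ≤ ∑ i, a k i * s i := by
    intro s
    have e1 : ∀ i, ∑ j, ((a (Sum.inl i) j : ℚ) : ℝ) * s j = s i := by
      intro i
      simp [a, apply_ite (Rat.cast : ℚ → ℝ), ite_mul]
    have e2 : ∀ S, ∑ j, ((a (Sum.inr S) j : ℚ) : ℝ) * s j = ∑ j ∈ S.1, s j := by
      intro S
      simp [a, apply_ite (Rat.cast : ℚ → ℝ), ite_mul]
    simp only [κ, Sum.forall, e1, e2]
    simp [LPFeasible, β]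
  -- The optimal point `r` is the midpoint of the feasible points `q` and `2 * r - q`, so the
  -- objective takes the optimal value at `q` as well.
  obtain ⟨q, hq, hq'⟩ := exists_rat_solution_near a β r ((hfeas r).1 hr)
  have hqf : LPFeasible X M fun i => (q i : ℝ) := (hfeas _).2 hq
  have hqf' : LPFeasible X M fun i => 2 * r i - q i := (hfeas _).2 hq'
  have h1 := hmin ⟨_, hqf, rfl⟩
  have h2 := hmin ⟨_, hqf', rfl⟩
  rw [Finset.sum_sub_distrib, ← Finset.mul_sum] at h2
  have hLpos : 0 < ∏ i, (q i).den := Finset.prod_pos fun i _ => (q i).den_pos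
  refine ⟨∏ i, (q i).den, hLpos, fun i => (q i : ℝ), hqf, fun i => ?_, by linarith⟩
  have hqi : 0 ≤ q i := Rat.cast_nonneg.1 (hqf.1 i)
  obtain ⟨m, hm⟩ := Finset.dvd_prod_of_mem (fun i => (q i).den) (Finset.mem_univ i)
  refine ⟨(q i).num.toNat * m, ?_⟩
  rw [eq_div_iff (by exact_mod_cast hLpos.ne'), hm]
  have hnum : (((q i).num.toNat : ℤ) : ℚ) = q i * (q i).den := by
    rw [Int.toNat_of_nonneg (Rat.num_nonneg.2 hqi), Rat.mul_den_eq_num]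
  have hnum' : ((q i).num.toNat : ℝ) = q i * (q i).den := by exact_mod_cast hnum
  push_cast
  rw [hnum']
  ring

theorem exists_isLeast_lpValuesDiv {L : ℕ} (hL : 1 ≤ L) :
    ∃ v, IsLeast (lpValuesDiv X M L) v := by
  classical
  have hL0 : (L : ℝ) ≠ 0 := by positivity
  -- All values are natural multiples of `1 / L`, so well-ordering gives the least one.
  have hform : ∀ s ∈ lpValuesDiv X M L, ∃ n : ℕ, s = n / L := by
    rintro s ⟨r, -, hn, rfl⟩
    choose n hn using hn
    refine ⟨∑ i, n i, ?_⟩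
    push_cast
    rw [Finset.sum_div]
    exact Finset.sum_congr rfl fun i _ => hn i
  have hne : ∃ n : ℕ, (n : ℝ) / L ∈ lpValuesDiv X M L := by
    have hmem : ∑ _i : Fin N, (K : ℝ) ∈ lpValuesDiv X M L :=
      ⟨_, lpFeasible_const X M, fun _ => ⟨K * L, by push_cast; field_simp⟩, rfl⟩
    obtain ⟨n, hn⟩ := hform _ hmem
    exact ⟨n, hn ▸ hmem⟩
  refine ⟨(Nat.find hne : ℝ) / L, Nat.find_spec hne, fun s hs => ?_⟩
  obtain ⟨n, rfl⟩ := hform s hs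
  have := Nat.find_min' hne hs
  gcongr

end LinearProgram

/-! ### Comparison of the schemes with the program -/

theorem lpValuesDiv_subset_lpValues {N K : ℕ} (X : Fin N → Finset (Fin K)) (M L : ℕ) :
    lpValuesDiv X M L ⊆ lpValues X M := by
  rintro s ⟨r, hr, -, rfl⟩
  exact ⟨r, hr, rfl⟩

theorem theorem1 (N M K : ℕ) (hM : M < N) (X : Fin N → Finset (Fin K)) :
    (∃ v : ℝ, IsLeast (lpValues X M) v ∧
      IsLeast {s | ∃ L : ℕ, 1 ≤ L ∧ s ∈ robustTotals X M L} v ∧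
      IsLeast {s | ∃ L : ℕ, 1 ≤ L ∧ s ∈ robustLinearTotals X M L} v) ∧
    (∀ L : ℕ, 1 ≤ L → ∃ v : ℝ, IsLeast (lpValuesDiv X M L) v ∧
      IsLeast (robustTotals X M L) v ∧
      IsLeast (robustLinearTotals X M L) v) := by
  have hlin : ∀ L, 1 ≤ L → robustLinearTotals X M L = lpValuesDiv X M L := fun L hL =>
    ((robustLinearTotals_subset_robustTotals X M L).trans
      (robustTotals_subset_lpValuesDiv X M hL)).antisymm
      (lpValuesDiv_subset_robustLinearTotals X M L hL)
  have htot : ∀ L, 1 ≤ L → robustTotals X M L = lpValuesDiv X M L := fun L hL =>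
    (robustTotals_subset_lpValuesDiv X M hL).antisymm
      ((lpValuesDiv_subset_robustLinearTotals X M L hL).trans
        (robustLinearTotals_subset_robustTotals X M L))
  constructor
  · obtain ⟨v, hv⟩ := exists_isLeast_lpValues X M
    obtain ⟨L, hL, hvL⟩ := exists_mem_lpValuesDiv_of_isLeast X M hv
    refine ⟨v, hv, ⟨⟨L, hL, htot L hL ▸ hvL⟩, ?_⟩, ⟨⟨L, hL, hlin L hL ▸ hvL⟩, ?_⟩⟩
    · rintro s ⟨L', hL', hs⟩
      exact hv.2 (lpValuesDiv_subset_lpValues X M L' (htot L' hL' ▸ hs))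
    · rintro s ⟨L', hL', hs⟩
      exact hv.2 (lpValuesDiv_subset_lpValues X M L' (hlin L' hL' ▸ hs))
  · intro L hL
    obtain ⟨v, hv⟩ := exists_isLeast_lpValuesDiv X M hL
    exact ⟨v, hv, (htot L hL).symm ▸ hv, (hlin L hL).symm ▸ hv⟩
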